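/- For $n\ge 1$, a run of a word of distinct numbers is a maximal segment of at least two consecutive letters which is increasing or decreasing. Let $\mathrm{run}(\pi)$ be the number of runs of $\pi=\pi(1)\cdots\pi(n)\in\mathfrak S_n$, and let $\mathrm{as}(\pi)$ be the length of the longest subsequence $\pi(i_1)>\pi(i_2)<\pi(i_3)>\cdots\pi(i_k)$ with $i_1<i_2<\cdots<i_k$. Define the type $A$ alternating run polynomials and the up-down run polynomials by $$R_n(x)=\sum_{\pi\in\mathfrak S_n}x^{\mathrm{run}(\pi)},\qquad S_n(x)=\sum_{\pi\in\mathfrak S_n}x^{\mathrm{as}(\pi)}.$$ Let $\mathcal B_n$ be the group of permutations $\pi$ of $\{\pm1,\dots,\pm n\}$ with $\pi(-i)=-\pi(i)$ for all $i$, let $T(n,k)$ be the number of $\pi\in\mathcal B_n$ with $\pi(1)>0$ such that the word $0\,\pi(1)\cdots\pi(n)$ has exactly $k$ runs, and define the type $B$ alternating run polynomials by $T_n(x)=\sum_{k=1}^nT(n,k)x^k$. For $k\ge1$ put $t_{2k-1}(x)=(1+x)(1-x^2)^{k-1}$ and $t_{2k}(x)=-(1-x^2)^k$. Then, for every $n\ge1$,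 $$T_{n+1}(x)=2^nx\,S_n(x)+\sum_{r=2}^{n+1}\binom{n}{r-2}t_{n-r+2}(x)\,T_{r-1}(x),$$ and, for every $n\ge2$, $$T_{n+1}(x)=2^{n-1}x(1+x)R_n(x)+\sum_{r=2}^{n+1}\binom{n}{r-2}t_{n-r+2}(x)\,T_{r-1}(x).$$ -/

import Mathlib

open Polynomial

namespace AltRuns

/-! ### Runs of a word -/

/-- The segment `w i, w (i+1), …, w j` (with `i < j`) of the word `w` is strictly increasing or
strictly decreasing. -/
def IsMonotoneSegment {m : ℕ} (w : Fin m → ℤ) (i j : Fin m) : Prop :=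
  i < j ∧ ((∀ a b : Fin m, i ≤ a → a < b → b ≤ j → w a < w b) ∨
    (∀ a b : Fin m, i ≤ a → a < b → b ≤ j → w b < w a))

instance {m : ℕ} (w : Fin m → ℤ) (i j : Fin m) : Decidable (IsMonotoneSegment w i j) := by
  unfold IsMonotoneSegment; infer_instance

/-- The segment `w i, …, w j` is an (alternating) run of `w`: a monotone segment that is not
properly contained in another monotone segment. -/
def IsRun {m : ℕ} (w : Fin m → ℤ) (i j : Fin m) : Prop :=
  IsMonotoneSegment w i j ∧
    ∀ i' j' : Fin m, i' ≤ i → j ≤ j' → IsMonotoneSegment w i' j' → i' = i ∧ j' = j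

instance {m : ℕ} (w : Fin m → ℤ) (i j : Fin m) : Decidable (IsRun w i j) := by
  unfold IsRun; infer_instance

/-- The number of (alternating) runs of a word. -/
def runCount {m : ℕ} (w : Fin m → ℤ) : ℕ :=
  (Finset.univ.filter fun p : Fin m × Fin m => IsRun w p.1 p.2).card

/-! ### Permutations: type A alternating runs and alternating subsequences -/

/-- The word `π(1) π(2) ⋯ π(n)` of a permutation of `[n] = {1, …, n}`. Here `[n]` is represented
by `Fin n` through `i ↦ i + 1`. -/
def permWord {n : ℕ} (π : Equiv.Perm (Fin n)) : Fin n → ℤ := fun i => ((π i : ℕ) : ℤ) + 1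

/-- The type A alternating run polynomial `R_n(x) = ∑_{π ∈ S_n} x ^ run(π)`. -/
noncomputable def R (n : ℕ) : ℤ[X] :=
  ∑ π : Equiv.Perm (Fin n), X ^ runCount (permWord π)

/-- The positions `idx 0 < idx 1 < ⋯ < idx (k-1)` select an alternating subsequence
`w(idx 0) > w(idx 1) < w(idx 2) > ⋯` of length `k` of the word `w`. -/
def IsAlternatingSubseq {m k : ℕ} (w : Fin m → ℤ) (idx : Fin k → Fin m) : Prop :=
  (∀ a b : Fin k, a < b → idx a < idx b) ∧
    ∀ a b : Fin k, (a : ℕ) + 1 = (b : ℕ) →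
      if Even (a : ℕ) then w (idx b) < w (idx a) else w (idx a) < w (idx b)

instance {m k : ℕ} (w : Fin m → ℤ) (idx : Fin k → Fin m) :
    Decidable (IsAlternatingSubseq w idx) := by
  unfold IsAlternatingSubseq; infer_instance

/-- The length of the longest alternating subsequence of a word of length `m` (a subsequence has
length at most `m`). -/
def longestAlt {m : ℕ} (w : Fin m → ℤ) : ℕ :=
  Nat.findGreatest (fun k => ∃ idx : Fin k → Fin m, IsAlternatingSubseq w idx) m

/-- The up-down run polynomial `S_n(x) = ∑_{π ∈ S_n} x ^ as(π)`. -/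
noncomputable def S (n : ℕ) : ℤ[X] :=
  ∑ π : Equiv.Perm (Fin n), X ^ longestAlt (permWord π)

/-! ### Signed permutations: type B alternating runs -/

/-- The set `±[n] = {±1, ±2, …, ±n}`. -/
abbrev PMSet (n : ℕ) : Type := {z : ℤ // z ∈ (Finset.Icc (-(n : ℤ)) n).erase 0}

/-- The map `i ↦ -i` on `±[n]`. -/
def PMSet.neg {n : ℕ} (i : PMSet n) : PMSet n :=
  ⟨-i.1, by have h := i.2; simp only [Finset.mem_erase, Finset.mem_Icc] at h ⊢; omega⟩

/-- The element `i + 1` of `±[n]`, for `0 ≤ i < n`. -/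
def PMSet.pos {n : ℕ} (i : Fin n) : PMSet n :=
  ⟨((i : ℕ) : ℤ) + 1, by
    have h := i.2; simp only [Finset.mem_erase, Finset.mem_Icc]; omega⟩

/-- The hyperoctahedral group `B_n`: the permutations `π` of `±[n]` such that `π(-i) = -π(i)`. -/
abbrev SignedPerm (n : ℕ) : Type :=
  {π : Equiv.Perm (PMSet n) // ∀ i : PMSet n, π i.neg = (π i).neg}

/-- The word `π(0) π(1) ⋯ π(n)` of a signed permutation, where `π(0) = 0`. -/
def signedWord {n : ℕ} (π : SignedPerm n) : Fin (n + 1) → ℤ :=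
  Fin.cons 0 fun i : Fin n => (π.1 (PMSet.pos i)).1

/-- Up signed permutations: `π(1) > 0`. -/
def IsUp {n : ℕ} (π : SignedPerm n) : Prop :=
  ∀ i : Fin n, (i : ℕ) = 0 → 0 < (π.1 (PMSet.pos i)).1

instance {n : ℕ} (π : SignedPerm n) : Decidable (IsUp π) := by
  unfold IsUp; infer_instance

/-- `T(n,k)`: the number of up signed permutations in `B_n` with `k` alternating runs. -/
noncomputable def upRunNumber (n k : ℕ) : ℕ :=
  (Finset.univ.filter fun π : SignedPerm n => IsUp π ∧ runCount (signedWord π) = k).card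

/-- The type B alternating run polynomial `T_n(x) = ∑_{k=1}^n T(n,k) x^k`. -/
noncomputable def T (n : ℕ) : ℤ[X] :=
  ∑ k ∈ Finset.Icc 1 n, C (upRunNumber n k : ℤ) * X ^ k

/-- `t_{2k-1}(x) = (1+x)(1-x^2)^{k-1}` and `t_{2k}(x) = -(1-x^2)^k`, for `k ≥ 1`. -/
noncomputable def t (m : ℕ) : ℤ[X] :=
  if Odd m then (1 + X) * (1 - X ^ 2) ^ ((m - 1) / 2) else -(1 - X ^ 2) ^ (m / 2)

end AltRuns

/-! Both sides are compared through first-order differential recurrences. Insert an extreme letter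
behind the fixed first letter of a word: the number of runs grows by 0, 1 or 2, and how many
positions give each increase depends only on the length, the number of runs and the direction of the
first step (`sum_turnCount_insertIdx`). Since as(π) is the number of runs of 0π
(`longestAlt_eq_listRuns`), inserting the largest letter yields `S_succ`. Inserting ±(n+1) into
signed permutations yields `signedRunPoly_succ_succ`; negating all values shows that the up ones
account for exactly half, whence `T_succ_succ`.

Extended by t_0 = -1, the polynomials t_m satisfy t_{m+1} = (2mx² - 1 - x) t_m + 2x(1 - x²) t_m'. By
Pascal's rule and the Leibniz rule, the convolution ∑ C(n,i) T_{i+1} t_{n-i} then obeys the same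
recurrence as -2^n x S_n, and both equal -x at n = 0 (`convolution_eq`). Its term i = n is -T_{n+1};
isolating it gives the first identity. The second follows from 2 S_n = (1 + x) R_n for n ≥ 2
(`two_mul_S`). -/

namespace AltRuns

/-! ### Runs of lists and insertion of an extreme letter -/

/-- The number of changes of direction in the word `a :: l`, where the letter `a` is regarded as
having been reached by an ascent if `up` holds and by a descent otherwise. -/
def turnCount (up : Bool) (a : ℤ) : List ℤ → ℕ
  | [] => 0
  | b :: l => (if up = decide (a < b) then 0 else 1) + turnCount (decide (a < b)) b l

/-- The number of alternating runs of a list, computed recursively. -/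
def listRuns : List ℤ → ℕ
  | a :: b :: l => 1 + turnCount (decide (a < b)) b l
  | _ => 0

theorem turnCount_le_length (up : Bool) (a : ℤ) (l : List ℤ) : turnCount up a l ≤ l.length := by
  induction l generalizing up a with
  | nil => simp [turnCount]
  | cons b l ih =>
    have := ih (decide (a < b)) b
    simp only [turnCount, List.length_cons]
    split_ifs <;> omega

theorem turnCount_le_succ (up up' : Bool) (a : ℤ) (l : List ℤ) :
    turnCount up a l ≤ 1 + turnCount up' a l := by
  cases l with
  | nil => simp [turnCount]
  | cons b l =>
    simp only [turnCount]
    split_ifs <;> omega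

/-- The letter `m` is larger (if `u` holds) or smaller (otherwise) than `a`. -/
def Beyond (u : Bool) (m a : ℤ) : Prop := decide (a < m) = u ∧ decide (m < a) = !u

/-- For m a new maximum: the two gaps beside an interior peak keep the number of turns, most other
gaps add two, and only gaps at the ends of the word can add one. The extra summand on the left is
the insertion just before `a`, which is reached in direction `u` whatever the earlier step was. Both
initial directions are treated together because the induction may switch between them. -/
theorem sum_turnCount_insertIdx (u : Bool) (m a : ℤ) (l : List ℤ) (ha : Beyond u m a)
    (hl : ∀ b ∈ l, Beyond u m b) :
    (∑ i ∈ Finset.range (l.length + 1), (X : ℤ[X]) ^ turnCount u a (l.insertIdx i m)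
        + X ^ (1 + turnCount (!u) a l)
      = ((turnCount u a l : ℤ[X]) + 1) * X ^ turnCount u a l + X ^ (turnCount u a l + 1)
        + ((l.length : ℤ[X]) - (turnCount u a l : ℤ[X])) * X ^ (turnCount u a l + 2)) ∧
    (∑ i ∈ Finset.range (l.length + 1), (X : ℤ[X]) ^ turnCount (!u) a (l.insertIdx i m)
        + X ^ (1 + turnCount (!u) a l)
      = (turnCount (!u) a l : ℤ[X]) * X ^ turnCount (!u) a l + 2 * X ^ (turnCount (!u) a l + 1)
        + ((l.length : ℤ[X]) - (turnCount (!u) a l : ℤ[X])) * X ^ (turnCount (!u) a l + 2)) := by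
  induction l generalizing a with
  | nil =>
    obtain ⟨h1, h2⟩ := ha
    constructor
    · simp [turnCount, h1]
    · cases u <;> simp [turnCount, h1] <;> ring
  | cons b l ih =>
    have hb := hl b (by simp)
    obtain ⟨i1, i2⟩ := ih b hb fun c hc => hl c (by simp [hc])
    obtain ⟨h1, h2⟩ := ha
    obtain ⟨h3, h4⟩ := hb
    rw [Finset.sum_range_succ', Finset.sum_range_succ' _ (b :: l).length]
    simp only [List.insertIdx_succ_cons, List.insertIdx_zero, turnCount, h1, h4, List.length_cons]
    -- Both claims follow from `i1` if the step from `a` to `b` has direction `u`, and from `i2`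
    -- otherwise; a factor `X` appears when that step is a turn.
    by_cases hab : a < b <;> cases u <;>
      simp [hab, pow_add, ← Finset.mul_sum] at i1 i2 ⊢ <;> constructor
    all_goals first
      | linear_combination i1
      | linear_combination i2
      | linear_combination X * i1
      | linear_combination X * i2

/-- Insertion of an extreme letter after the first letter, when the first step goes towards it. -/
theorem sum_listRuns_insertIdx_same (u : Bool) (m z a : ℤ) (l : List ℤ) (hz : Beyond u m z)
    (hl : ∀ b ∈ a :: l, Beyond u m b) (hd : decide (z < a) = u) :
    ∑ i ∈ Finset.range (l.length + 2), (X : ℤ[X]) ^ listRuns (z :: (a :: l).insertIdx i m)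
      = (listRuns (z :: a :: l) : ℤ[X]) * X ^ listRuns (z :: a :: l)
        + X ^ (listRuns (z :: a :: l) + 1)
        + ((l.length : ℤ[X]) + 1 - (listRuns (z :: a :: l) : ℤ[X])) * X ^ (listRuns (z :: a :: l) + 2) := by
  have ha := hl a (by simp)
  have := (sum_turnCount_insertIdx u m a l ha fun c hc => hl c (by simp [hc])).1
  rw [Finset.sum_range_succ']
  simp only [List.insertIdx_succ_cons, List.insertIdx_zero, listRuns, hd, turnCount, hz.1, ha.2]
  simp [pow_add, ← Finset.mul_sum] at this ⊢
  linear_combination X * this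

/-- Insertion of an extreme letter after the first letter, when the first step goes away from
it. -/
theorem sum_listRuns_insertIdx_opposite (u : Bool) (m z a : ℤ) (l : List ℤ) (hz : Beyond u m z)
    (hl : ∀ b ∈ a :: l, Beyond u m b) (hd : decide (z < a) = !u) :
    ∑ i ∈ Finset.range (l.length + 2), (X : ℤ[X]) ^ listRuns (z :: (a :: l).insertIdx i m)
      = ((listRuns (z :: a :: l) : ℤ[X]) - 1) * X ^ listRuns (z :: a :: l)
        + 2 * X ^ (listRuns (z :: a :: l) + 1)
        + ((l.length : ℤ[X]) + 1 - (listRuns (z :: a :: l) : ℤ[X])) * X ^ (listRuns (z :: a :: l) + 2) := by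
  have ha := hl a (by simp)
  have := (sum_turnCount_insertIdx u m a l ha fun c hc => hl c (by simp [hc])).2
  rw [Finset.sum_range_succ']
  simp only [List.insertIdx_succ_cons, List.insertIdx_zero, listRuns, hd, turnCount, hz.1, ha.2]
  simp [pow_add, ← Finset.mul_sum] at this ⊢
  linear_combination X * this

/-- Every comparison of neighbours is reversed, so turns stay turns. Distinctness matters: equal
letters would count as a descent both before and after. -/
theorem turnCount_map_strictAnti {f : ℤ → ℤ} (hf : StrictAnti f) (up : Bool) (a : ℤ) (l : List ℤ)
    (hl : (a :: l).Nodup) : turnCount (!up) (f a) (l.map f) = turnCount up a l := by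
  induction l generalizing up a with
  | nil => simp [turnCount]
  | cons b l ih =>
    have hab : a ≠ b := fun h => by simp [h] at hl
    have h : decide (f a < f b) = !decide (a < b) := by
      rcases lt_or_gt_of_ne hab with h | h
      · simp [h, (hf h).not_gt]
      · simp [h.not_gt, hf h]
    simp only [List.map_cons, turnCount, h, ih _ b (List.nodup_cons.1 hl).2]
    simp

theorem listRuns_map_strictAnti {f : ℤ → ℤ} (hf : StrictAnti f) (l : List ℤ) (hl : l.Nodup) :
    listRuns (l.map f) = listRuns l := by
  match l, hl with
  | [], _ => rfl
  | [_], _ => rfl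
  | a :: b :: l, hl =>
    have hab : a ≠ b := fun h => by simp [h] at hl
    have h : decide (f a < f b) = !decide (a < b) := by
      rcases lt_or_gt_of_ne hab with h | h
      · simp [h, (hf h).not_gt]
      · simp [h.not_gt, hf h]
    simp only [List.map_cons, listRuns, h,
      turnCount_map_strictAnti hf _ b l (List.nodup_cons.1 hl).2]

theorem listRuns_cons_cons_cons (z a b : ℤ) (l : List ℤ) (hz : z < a) :
    listRuns (z :: a :: b :: l) = listRuns (a :: b :: l) + if a < b then 0 else 1 := by
  simp only [listRuns, turnCount, hz]
  by_cases h : a < b <;> simp [h]; omega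

/-! ### Runs -/

/-- The letters at positions `i-1`, `i`, `i+1` do not form a monotone segment. -/
def IsTurn {m : ℕ} (w : Fin m → ℤ) (i : ℕ) (h : i + 2 < m) : Prop :=
  decide (w ⟨i, by omega⟩ < w ⟨i + 1, by omega⟩) ≠ decide (w ⟨i + 1, by omega⟩ < w ⟨i + 2, h⟩)

instance {m : ℕ} (w : Fin m → ℤ) (i : ℕ) (h : i + 2 < m) : Decidable (IsTurn w i h) := by
  unfold IsTurn; infer_instance

theorem IsMonotoneSegment.mono {m : ℕ} {w : Fin m → ℤ} {i j i' j' : Fin m}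
    (h : IsMonotoneSegment w i j) (hi : i ≤ i') (hj : j' ≤ j) (hij : i' < j') :
    IsMonotoneSegment w i' j' :=
  ⟨hij, h.2.imp (fun h a b h1 h2 h3 => h a b (hi.trans h1) h2 (h3.trans hj))
    (fun h a b h1 h2 h3 => h a b (hi.trans h1) h2 (h3.trans hj))⟩

theorem IsMonotoneSegment.succ {m : ℕ} {w : Fin m → ℤ} (hw : Function.Injective w) {i j : Fin m}
    (h : (i : ℕ) + 1 = j) : IsMonotoneSegment w i j := by
  have hij : i < j := by rw [Fin.lt_def]; omega
  have key : ∀ a b : Fin m, i ≤ a → a < b → b ≤ j → a = i ∧ b = j := by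
    intro a b h1 h2 h3
    rw [Fin.le_def] at h1 h3
    rw [Fin.lt_def] at h2
    constructor <;> ext <;> omega
  refine ⟨hij, ?_⟩
  rcases lt_or_gt_of_ne (hw.ne hij.ne) with h' | h'
  · left
    intro a b h1 h2 h3
    obtain ⟨rfl, rfl⟩ := key a b h1 h2 h3
    exact h'
  · right
    intro a b h1 h2 h3
    obtain ⟨rfl, rfl⟩ := key a b h1 h2 h3
    exact h'

/-- A monotone segment extends to the left across a position which is not a turn. -/
theorem IsMonotoneSegment.extend {m : ℕ} {w : Fin m → ℤ} (hw : Function.Injective w) {i : ℕ}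
    {hi : i + 2 < m} {j : Fin m} (h : IsMonotoneSegment w ⟨i + 1, by omega⟩ j)
    (ht : ¬ IsTurn w i hi) : IsMonotoneSegment w ⟨i, by omega⟩ j := by
  have hij : i + 1 < (j : ℕ) := h.1
  refine ⟨by rw [Fin.lt_def]; exact (Nat.lt_succ_self i).trans hij, ?_⟩
  rw [IsTurn, not_not, decide_eq_decide] at ht
  have hne : w ⟨i, by omega⟩ ≠ w ⟨i + 1, by omega⟩ := hw.ne (by simp)
  have h12 : (⟨i + 1, by omega⟩ : Fin m) < ⟨i + 2, hi⟩ := by rw [Fin.lt_def]; simp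
  have h2j : (⟨i + 2, hi⟩ : Fin m) ≤ j := by rw [Fin.le_def]; exact hij
  have key : ∀ a : Fin m, (⟨i, by omega⟩ : Fin m) ≤ a →
      a = ⟨i, by omega⟩ ∨ (⟨i + 1, by omega⟩ : Fin m) ≤ a := by
    intro a ha
    rw [Fin.le_def] at ha ⊢
    rw [Fin.ext_iff]
    simp only at ha ⊢
    omega
  rcases h.2 with h | h
  · left
    have h0 := ht.2 (h _ _ le_rfl h12 h2j)
    intro a b ha hab hb
    rcases key a ha with rfl | ha
    · rcases key b hab.le with rfl | hb'
      · exact absurd hab (lt_irrefl _)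
      · rcases hb'.eq_or_lt with rfl | hb'
        · exact h0
        · exact h0.trans (h _ _ le_rfl hb' hb)
    · exact h a b ha hab hb
  · right
    have h0 := lt_of_le_of_ne (not_lt.1 fun h' => (ht.1 h').not_gt (h _ _ le_rfl h12 h2j)) hne.symm
    intro a b ha hab hb
    rcases key a ha with rfl | ha
    · rcases key b hab.le with rfl | hb'
      · exact absurd hab (lt_irrefl _)
      · rcases hb'.eq_or_lt with rfl | hb'
        · exact h0
        · exact (h _ _ le_rfl hb' hb).trans h0
    · exact h a b ha hab hb

theorem IsMonotoneSegment.not_isTurn {m : ℕ} {w : Fin m → ℤ} {i : ℕ} {hi : i + 2 < m}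
    (h : IsMonotoneSegment w ⟨i, by omega⟩ ⟨i + 2, hi⟩) : ¬ IsTurn w i hi := by
  have h1 : (⟨i, by omega⟩ : Fin m) < ⟨i + 1, by omega⟩ := by rw [Fin.lt_def]; simp
  have h2 : (⟨i + 1, by omega⟩ : Fin m) < ⟨i + 2, hi⟩ := by rw [Fin.lt_def]; simp
  rw [IsTurn, not_not, decide_eq_decide]
  rcases h.2 with h | h
  · exact iff_of_true (h _ _ le_rfl h1 h2.le) (h _ _ h1.le h2 le_rfl)
  · exact iff_of_false (h _ _ le_rfl h1 h2.le).not_gt (h _ _ h1.le h2 le_rfl).not_gt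

/-- A run starts at position `i` exactly if `i` is not the last position, and `i` is the first
position or a turn. -/
theorem exists_isRun_iff {m : ℕ} {w : Fin m → ℤ} (hw : Function.Injective w) (i : Fin m) :
    (∃ j, IsRun w i j) ↔
      (i : ℕ) + 1 < m ∧ ∀ k (hk : k + 2 < m), (i : ℕ) = k + 1 → IsTurn w k hk := by
  constructor
  · rintro ⟨j, hj, hmax⟩
    have hij : (i : ℕ) < j := hj.1
    refine ⟨by omega, fun k hk hik => ?_⟩
    by_contra ht
    obtain ⟨i, hi⟩ := i
    subst hik
    have := (hmax ⟨k, by omega⟩ j (by rw [Fin.le_def]; simp) le_rfl (hj.extend hw ht)).1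
    simp at this
  · rintro ⟨hi, ht⟩
    have hne : (Finset.univ.filter fun j => IsMonotoneSegment w i j).Nonempty :=
      ⟨⟨i + 1, hi⟩, by simpa using IsMonotoneSegment.succ hw rfl⟩
    obtain ⟨j, hj, hmax⟩ := Finset.exists_max_image _ id hne
    simp only [Finset.mem_filter, Finset.mem_univ, true_and, id] at hj hmax
    refine ⟨j, hj, fun i' j' hi' hj' h => ?_⟩
    have hii : i' = i := by
      by_contra hcon
      have hlt : (i' : ℕ) < i := lt_of_le_of_ne hi' fun h => hcon (Fin.ext h)
      have hij : (i : ℕ) < j := hj.1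
      obtain ⟨k, hk⟩ : ∃ k, (i : ℕ) = k + 1 := ⟨i - 1, by omega⟩
      refine (IsMonotoneSegment.not_isTurn (hi := by omega) ?_) (ht k (by omega) hk)
      refine h.mono ?_ (le_trans ?_ hj') ?_
      · rw [Fin.le_def]; simp only; omega
      · rw [Fin.le_def]; simp only; omega
      · rw [Fin.lt_def]; simp
    subst hii
    exact ⟨rfl, le_antisymm (hmax j' h) hj'⟩

-- A run is determined by its starting position: of two runs with the same start, maximality of the
-- shorter one forces equality.
open Classical in
theorem runCount_eq_card {m : ℕ} {w : Fin m → ℤ} (hw : Function.Injective w) :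
    runCount w = (Finset.univ.filter fun i : Fin m =>
      (i : ℕ) + 1 < m ∧ ∀ k (hk : k + 2 < m), (i : ℕ) = k + 1 → IsTurn w k hk).card := by
  rw [runCount]
  refine Finset.card_bij (fun p _ => p.1) ?_ ?_ ?_
  · rintro ⟨i, j⟩ h
    simp only [Finset.mem_filter, Finset.mem_univ, true_and] at h ⊢
    exact (exists_isRun_iff hw i).1 ⟨j, h⟩
  · rintro ⟨i, j⟩ h ⟨i', j'⟩ h' (rfl : i = i')
    simp only [Finset.mem_filter, Finset.mem_univ, true_and] at h h'
    rcases le_total j j' with hjj | hjj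
    · rw [(h.2 i j' le_rfl hjj h'.1).2]
    · rw [(h'.2 i j le_rfl hjj h.1).2]
  · intro i h
    simp only [Finset.mem_filter, Finset.mem_univ, true_and] at h
    obtain ⟨j, hj⟩ := (exists_isRun_iff hw i).2 h
    exact ⟨(i, j), by simpa using hj, rfl⟩

theorem listRuns_ofFn (m : ℕ) (w : Fin (m + 2) → ℤ) :
    listRuns (List.ofFn w) = 1 + ∑ k : Fin m, if IsTurn w k (by omega) then 1 else 0 := by
  induction m with
  | zero => simp [listRuns, List.ofFn_succ, turnCount]
  | succ m ih =>
    have h := ih (Fin.tail w)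
    rw [List.ofFn_succ, List.ofFn_succ] at h
    rw [List.ofFn_succ, List.ofFn_succ, List.ofFn_succ, Fin.sum_univ_succ]
    simp only [listRuns, turnCount] at h ⊢
    have e : ∀ k : Fin m, IsTurn w (k.succ : Fin (m + 1)) (by simp) ↔
        IsTurn (Fin.tail w) k (by omega) := fun k => Iff.rfl
    have e0 : IsTurn w ((0 : Fin (m + 1)) : ℕ) (by simp) ↔
      ¬ (decide (w 0 < w (Fin.succ 0)) = decide (w (Fin.succ 0) < w (Fin.succ (Fin.succ 0)))) :=
        Iff.rfl
    simp only [e, e0]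
    rw [← add_left_cancel h]
    simp only [Fin.tail, ite_not]
    rfl

theorem runCount_eq_listRuns {m : ℕ} {w : Fin m → ℤ} (hw : Function.Injective w) :
    runCount w = listRuns (List.ofFn w) := by
  rw [runCount_eq_card hw]
  match m, w, hw with
  | 0, w, _ => simp [listRuns]
  | 1, w, _ => simp [listRuns]
  | m + 2, w, _ =>
    rw [listRuns_ofFn, Finset.card_filter, Fin.sum_univ_succ, Fin.sum_univ_castSucc]
    -- The first position always starts a run, the last never does, and those in between do exactly
    -- at turns.
    have h0 : ((0 : Fin (m + 2)) : ℕ) + 1 < m + 2 ∧ ∀ k (hk : k + 2 < m + 2),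
        ((0 : Fin (m + 2)) : ℕ) = k + 1 → IsTurn w k hk := by simp
    have hl : ¬ (((Fin.last m).succ : ℕ) + 1 < m + 2 ∧ ∀ k (hk : k + 2 < m + 2),
        ((Fin.last m).succ : ℕ) = k + 1 → IsTurn w k hk) := by simp
    have hk (i : Fin m) : ((i.castSucc.succ : ℕ) + 1 < m + 2 ∧ ∀ k (hk : k + 2 < m + 2),
        (i.castSucc.succ : ℕ) = k + 1 → IsTurn w k hk) ↔ IsTurn w i (by omega) := by
      constructor
      · rintro ⟨-, h⟩
        exact h i _ (by simp)
      · refine fun h => ⟨by simp, fun k hk hik => ?_⟩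
        obtain rfl : (i : ℕ) = k := by simpa using hik
        exact h
    rw [if_pos h0, if_neg hl, add_zero]
    simp only [hk]

/-! ### Alternating subsequences -/

/-- Consecutive letters of the list alternately descend and ascend, starting with a descent if
`down` holds. -/
def Alternates (down : Bool) : List ℤ → Prop
  | a :: b :: l => (if down then b < a else a < b) ∧ Alternates (!down) (b :: l)
  | _ => True

theorem alternates_iff (d : Bool) (l : List ℤ) : Alternates d l ↔
    ∀ i (h : i + 1 < l.length), if (Even i ↔ d = true) then l[i + 1] < l[i] else l[i] < l[i + 1] := by
  induction l generalizing d with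
  | nil => simp [Alternates]
  | cons a l ih =>
    cases l with
    | nil => simp [Alternates]
    | cons b l =>
      rw [Alternates, ih]
      constructor
      · rintro ⟨h0, h⟩ i hi
        cases i with
        | zero => cases d <;> simpa using h0
        | succ i =>
          have := h i (by simpa using hi)
          cases d <;> simpa [Nat.even_add_one] using this
      · intro h
        refine ⟨?_, fun i hi => ?_⟩
        · have := h 0 (by simp)
          cases d <;> simpa using this
        · have := h (i + 1) (by simpa using hi)
          cases d <;> simpa [Nat.even_add_one] using this

/-- Suppose the subsequence uses `a`. If the step to `b` continues in direction `d`, then `b` lies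
further out and can replace `a`; if it turns, the letters after `a` form a subsequence of `b :: l`
of the opposite phase, and the turn pays for `a`. -/
theorem Alternates.length_le (d : Bool) (a : ℤ) (l s : List ℤ) (hl : (a :: l).Nodup)
    (hs : s.Sublist (a :: l)) (h : Alternates d s) : s.length ≤ 1 + turnCount d a l := by
  induction l generalizing d a s with
  | nil => simpa [turnCount] using hs.length_le
  | cons b l ih =>
    have hl' := (List.nodup_cons.1 hl).2
    have hab : a ≠ b := fun h => by simp [h] at hl
    have hdir : decide (a < b) = false → b < a := fun h => by
      simp at h; exact lt_of_le_of_ne h hab.symm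
    rcases List.sublist_cons_iff.1 hs with hs | ⟨r, rfl, hr⟩
    · have h1 := ih d b s hl' hs h
      have h2 := turnCount_le_succ d (decide (a < b)) b l
      simp only [turnCount]
      split_ifs with hd
      · rw [← hd]; omega
      · omega
    · cases r with
      | nil => simp
      | cons c r =>
        obtain ⟨hc, hr'⟩ := h
        simp only [turnCount]
        by_cases hd : d = decide (a < b)
        · have hcr : (c :: r).Sublist l := by
            rcases List.sublist_cons_iff.1 hr with hr | ⟨r', hr2, -⟩
            · exact hr
            · obtain ⟨rfl, rfl⟩ := List.cons.inj hr2
              cases d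
              · have := hdir hd.symm
                simp at hc; omega
              · simp at hd hc; omega
          have : Alternates d (b :: c :: r) := by
            refine ⟨?_, hr'⟩
            cases d
            · have := hdir hd.symm
              simp at hc ⊢; omega
            · simp at hd hc ⊢; omega
          have := ih d b _ hl' (hcr.cons_cons b) this
          rw [if_pos hd, ← hd]
          simp at this ⊢; omega
        · have hd' : (!d) = decide (a < b) := by revert hd; cases d <;> cases decide (a < b) <;> simp
          have := ih _ b _ hl' hr hr'
          rw [if_neg hd, ← hd']
          simp at this ⊢; omega

/-- Select the turning points and the last letter. The final clause, that `c` is at least as far out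
as `a`, is what allows an earlier letter to be prepended at a turn. -/
theorem exists_alternates (d : Bool) (a : ℤ) (l : List ℤ) (hl : (a :: l).Nodup) :
    ∃ c s, (c :: s).Sublist (a :: l) ∧ Alternates d (c :: s) ∧
      (c :: s).length = 1 + turnCount d a l ∧ if d then a ≤ c else c ≤ a := by
  induction l generalizing d a with
  | nil => exact ⟨a, [], by simp, by simp [Alternates], by simp [turnCount], by simp⟩
  | cons b l ih =>
    have hl' := (List.nodup_cons.1 hl).2
    have hab : a ≠ b := fun h => by simp [h] at hl
    have hdir : decide (a < b) = false → b < a := fun h => by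
      simp at h; exact lt_of_le_of_ne h hab.symm
    simp only [turnCount]
    by_cases hd : d = decide (a < b)
    · obtain ⟨c, s, h1, h2, h3, h4⟩ := ih d b hl'
      refine ⟨c, s, h1.cons a, h2, by rw [if_pos hd, ← hd, h3]; omega, ?_⟩
      cases d
      · have := hdir hd.symm
        simp at h4 ⊢; omega
      · simp at hd h4 ⊢; omega
    · have hd' : (!d) = decide (a < b) := by revert hd; cases d <;> cases decide (a < b) <;> simp
      obtain ⟨c, s, h1, h2, h3, h4⟩ := ih (!d) b hl'
      refine ⟨a, c :: s, h1.cons_cons a, ⟨?_, h2⟩, by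
        rw [if_neg hd, ← hd', List.length_cons, h3]; omega, by simp⟩
      cases d
      · simp at hd' h4 ⊢; omega
      · have := hdir hd'.symm
        simp at h4 ⊢; omega

theorem exists_isAlternatingSubseq_iff {m : ℕ} (w : Fin m → ℤ) (k : ℕ) :
    (∃ idx : Fin k → Fin m, IsAlternatingSubseq w idx) ↔
      ∃ s : List ℤ, s.Sublist (List.ofFn w) ∧ s.length = k ∧ Alternates true s := by
  constructor
  · rintro ⟨idx, h1, h2⟩
    refine ⟨List.ofFn (w ∘ idx), ?_, by simp, ?_⟩
    · rw [List.sublist_iff_exists_fin_orderEmbedding_get_eq]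
      refine ⟨OrderEmbedding.ofStrictMono
        (fun i => Fin.cast (by simp) (idx (Fin.cast (by simp) i))) ?_, ?_⟩
      · intro i j hij
        exact h1 _ _ hij
      · intro i
        simp
        rfl
    · rw [alternates_iff]
      intro i hi
      have := h2 ⟨i, by simp at hi; omega⟩ ⟨i + 1, by simpa using hi⟩ rfl
      simpa using this
  · rintro ⟨s, hs, rfl, h⟩
    rw [List.sublist_iff_exists_fin_orderEmbedding_get_eq] at hs
    obtain ⟨f, hf⟩ := hs
    rw [alternates_iff] at h
    have hf' : ∀ i : Fin s.length, s[i] = w (Fin.cast (by simp) (f i)) := by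
      intro i
      have := hf i
      simp only [List.get_eq_getElem, List.getElem_ofFn] at this
      exact this
    refine ⟨fun i => Fin.cast (by simp) (f i), fun a b hab => f.strictMono hab, ?_⟩
    intro a b hab
    have := h a (by rw [hab]; exact b.2)
    rw [← hf' a, ← hf' b]
    simpa [hab] using this

/-- The leading 0 makes the first step an ascent, matching the requirement that the subsequence
begin with a descent. -/
theorem longestAlt_eq_listRuns {m : ℕ} {w : Fin m → ℤ} (hw : Function.Injective w)
    (hpos : ∀ i, 0 < w i) : longestAlt w = listRuns (0 :: List.ofFn w) := by
  cases m with
  | zero => simp [listRuns, longestAlt]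
  | succ m =>
    have hnd : (List.ofFn w).Nodup := List.nodup_ofFn.2 hw
    have hlen : (List.ofFn w).length = m + 1 := by simp
    have hsub := exists_isAlternatingSubseq_iff w
    rw [List.ofFn_succ] at hnd hlen hsub ⊢
    simp only [listRuns, hpos, decide_true]
    apply le_antisymm
    · obtain ⟨s, h1, h2, h3⟩ := (hsub _).1 <| Nat.findGreatest_spec
        (P := fun k => ∃ idx : Fin k → Fin (m + 1), IsAlternatingSubseq w idx)
        (Nat.zero_le (m + 1)) ((hsub 0).2 ⟨[], by simp, rfl, trivial⟩)
      exact h2.symm.trans_le (h3.length_le _ _ _ _ hnd h1)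
    · obtain ⟨c, s, h1, h2, h3, -⟩ := exists_alternates true _ _ hnd
      refine Nat.le_findGreatest ?_ ((hsub _).2 ⟨_, h1, h3, h2⟩)
      rw [← h3, ← hlen]
      exact h1.length_le

/-! ### Insertion of the largest letter into a permutation -/

theorem ofFn_insertNth {n : ℕ} (i : Fin (n + 1)) (x : ℤ) (w : Fin n → ℤ) :
    List.ofFn (i.insertNth (α := fun _ => ℤ) x w) = (List.ofFn w).insertIdx i x := by
  induction n with
  | zero =>
    obtain rfl : i = 0 := Fin.ext (by omega)
    simp [Fin.insertNth_zero']
  | succ n ih =>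
    cases i using Fin.cases with
    | zero => simp [Fin.insertNth_zero']
    | succ i =>
      rw [← Fin.cons_self_tail w, Fin.insertNth_succ_cons, List.ofFn_cons, List.ofFn_cons, ih]
      rfl

theorem permWord_injective {n : ℕ} (π : Equiv.Perm (Fin n)) : Function.Injective (permWord π) := by
  intro i j h
  refine π.injective (Fin.ext ?_)
  simpa [permWord] using h

theorem permWord_pos {n : ℕ} (π : Equiv.Perm (Fin n)) (i : Fin n) : 0 < permWord π i := by
  unfold permWord; omega

theorem permWord_le {n : ℕ} (π : Equiv.Perm (Fin n)) (i : Fin n) : permWord π i ≤ n := by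
  have := (π i).2
  unfold permWord; omega

theorem permWord_inj {n : ℕ} {π σ : Equiv.Perm (Fin n)} (h : permWord π = permWord σ) : π = σ := by
  ext i
  simpa [permWord] using congrFun h i

/-- Insertion of the largest letter at position `i`. -/
def permInsert {n : ℕ} (i : Fin (n + 1)) (σ : Equiv.Perm (Fin n)) : Equiv.Perm (Fin (n + 1)) :=
  (finSuccEquiv' i).trans ((Equiv.optionCongr σ).trans (finSuccEquiv' (Fin.last n)).symm)

theorem permWord_permInsert {n : ℕ} (i : Fin (n + 1)) (σ : Equiv.Perm (Fin n)) :
    permWord (permInsert i σ) = i.insertNth (α := fun _ => ℤ) ((n : ℤ) + 1) (permWord σ) := by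
  rw [Fin.eq_insertNth_iff]
  constructor
  · simp [permWord, permInsert]
  · funext j
    simp [permWord, permInsert, Fin.removeNth]

theorem permInsert_bijective (n : ℕ) :
    Function.Bijective fun p : Fin (n + 1) × Equiv.Perm (Fin n) => permInsert p.1 p.2 := by
  rw [Fintype.bijective_iff_injective_and_card]
  constructor
  · rintro ⟨i, σ⟩ ⟨j, τ⟩ h
    have h : permInsert i σ = permInsert j τ := h
    have h' := congrArg permWord h
    rw [permWord_permInsert, permWord_permInsert] at h'
    have hij : i = j := by
      apply permWord_injective (permInsert i σ)
      rw [permWord_permInsert, Fin.insertNth_apply_same, h', Fin.insertNth_apply_same]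
    subst hij
    rw [(Fin.insertNth_right_injective (α := fun _ => ℤ) _ |>.eq_iff)] at h'
    rw [permWord_inj h']
  · simp [Fintype.card_perm, Nat.factorial_succ]

theorem sum_perm_succ {n : ℕ} (f : Equiv.Perm (Fin (n + 1)) → ℤ[X]) :
    ∑ π, f π = ∑ σ : Equiv.Perm (Fin n), ∑ i, f (permInsert i σ) := by
  rw [← (Equiv.ofBijective _ (permInsert_bijective n)).sum_comp, Fintype.sum_prod_type_right]
  rfl

theorem S_eq (n : ℕ) :
    S n = ∑ π : Equiv.Perm (Fin n), X ^ listRuns (0 :: List.ofFn (permWord π)) := by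
  refine Finset.sum_congr rfl fun π _ => ?_
  rw [longestAlt_eq_listRuns (permWord_injective π) (permWord_pos π)]

theorem X_mul_derivative_X_pow (k : ℕ) : X * derivative (X ^ k : ℤ[X]) = (k : ℤ[X]) * X ^ k := by
  cases k with
  | zero => simp
  | succ k => rw [derivative_X_pow]; simp; ring

theorem S_succ (n : ℕ) :
    S (n + 1) = (X + (n : ℤ[X]) * X ^ 2) * S n + X * (1 - X ^ 2) * derivative (S n) := by
  rw [S_eq, S_eq, sum_perm_succ, derivative_sum, Finset.mul_sum, Finset.mul_sum,
    ← Finset.sum_add_distrib]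
  refine Finset.sum_congr rfl fun σ _ => ?_
  simp only [permWord_permInsert, ofFn_insertNth]
  rw [Fin.sum_univ_eq_sum_range
    (fun i => (X : ℤ[X]) ^ listRuns (0 :: (List.ofFn (permWord σ)).insertIdx i ((n : ℤ) + 1)))]
  cases n with
  | zero => simp [listRuns, turnCount]
  | succ n =>
    have hb : ∀ b ∈ List.ofFn (permWord σ), Beyond true ((n + 1 : ℕ) + 1) b := by
      intro b hb
      obtain ⟨i, rfl⟩ := (List.mem_ofFn' _ _).1 hb
      have := permWord_le σ i
      constructor
      · rw [decide_eq_true_iff]; omega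
      · simp only [Bool.not_true, decide_eq_false_iff_not]; omega
    have hlen : (List.ofFn (permWord σ)).length = n + 1 := by simp
    rw [List.ofFn_succ] at hb hlen ⊢
    have h0 : decide (0 < permWord σ 0) = true := by simpa using permWord_pos σ 0
    have hz : Beyond true ((n + 1 : ℕ) + 1) 0 := by
      constructor
      · rw [decide_eq_true_iff]; omega
      · simp only [Bool.not_true, decide_eq_false_iff_not]; omega
    have key := sum_listRuns_insertIdx_same true _ 0 _ _ hz hb h0
    rw [List.length_ofFn] at key
    rw [key]
    push_cast
    linear_combination (X ^ 2 - 1) * X_mul_derivative_X_pow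
      (listRuns (0 :: permWord σ 0 :: List.ofFn fun i => permWord σ i.succ))

/-! ### The relation between `S` and `R` -/

theorem permWord_trans_rev {n : ℕ} (π : Equiv.Perm (Fin n)) :
    permWord (π.trans Fin.revPerm) = fun i => (n : ℤ) + 1 - permWord π i := by
  funext i
  have := (π i).2
  simp only [permWord, Equiv.trans_apply, Fin.revPerm_apply, Fin.val_rev]
  omega

/-- A permutation and its complement have equally many runs, and exactly one of them starts with a
descent. Prepending 0 creates a new run precisely for that one, so each pair contributes (1 + x)
times a common power. For n = 1 there is no first step and the identity fails. -/
theorem two_mul_S (n : ℕ) (hn : 2 ≤ n) : 2 * S n = (1 + X) * R n := by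
  obtain ⟨n, rfl⟩ := Nat.exists_eq_add_of_le' hn
  have h : S (n + 2) = ∑ π : Equiv.Perm (Fin (n + 2)),
      X ^ listRuns (0 :: List.ofFn (permWord (π.trans Fin.revPerm))) := by
    rw [S_eq, ← Equiv.sum_comp (Equiv.mulLeft (Fin.revPerm : Equiv.Perm (Fin (n + 2))))]
    rfl
  rw [two_mul]
  nth_rewrite 2 [h]
  rw [S_eq, R, ← Finset.sum_add_distrib, Finset.mul_sum]
  refine Finset.sum_congr rfl fun π _ => ?_
  rw [runCount_eq_listRuns (permWord_injective π)]
  have hanti : StrictAnti fun z : ℤ => ((n + 2 : ℕ) : ℤ) + 1 - z := fun a b h => by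
    simp only; omega
  have hr : listRuns (List.ofFn (permWord (π.trans Fin.revPerm)))
      = listRuns (List.ofFn (permWord π)) := by
    rw [← listRuns_map_strictAnti hanti _ (List.nodup_ofFn.2 (permWord_injective π)),
      permWord_trans_rev, List.map_ofFn]
    rfl
  have hne : permWord π 0 ≠ permWord π 1 := (permWord_injective π).ne (by simp)
  have hsplit (w : Fin (n + 2) → ℤ) (h0 : 0 < w 0) : listRuns (0 :: List.ofFn w)
      = listRuns (List.ofFn w) + if w 0 < w 1 then 0 else 1 := by
    rw [List.ofFn_succ, List.ofFn_succ, listRuns_cons_cons_cons _ _ _ _ h0]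
    rfl
  rw [hsplit _ (permWord_pos _ _), hsplit _ (permWord_pos _ _), hr, permWord_trans_rev]
  beta_reduce
  rcases lt_or_gt_of_ne hne with h | h
  · rw [if_pos h, if_neg (by omega), pow_add, pow_add]; ring
  · rw [if_neg (by omega), if_pos (by omega), pow_add, pow_add]; ring

/-! ### Signed permutations -/

/-- The word of the signed permutation with absolute values `σ` and signs `ε`. -/
def signWord {n : ℕ} (σ : Equiv.Perm (Fin n)) (ε : Fin n → Bool) : Fin n → ℤ :=
  fun i => if ε i then permWord σ i else -permWord σ i

theorem natAbs_signWord {n : ℕ} (σ : Equiv.Perm (Fin n)) (ε : Fin n → Bool) (i : Fin n) :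
    (signWord σ ε i).natAbs = σ i + 1 := by
  unfold signWord permWord
  split_ifs <;> omega

theorem signWord_pos_iff {n : ℕ} (σ : Equiv.Perm (Fin n)) (ε : Fin n → Bool) (i : Fin n) :
    0 < signWord σ ε i ↔ ε i = true := by
  have := permWord_pos σ i
  unfold signWord
  split_ifs with h
  · simp [h, this]
  · simp [h, this.le]

theorem signWord_injective {n : ℕ} (σ : Equiv.Perm (Fin n)) (ε : Fin n → Bool) :
    Function.Injective (signWord σ ε) := by
  intro i j h
  have := congrArg Int.natAbs h
  rw [natAbs_signWord, natAbs_signWord] at this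
  exact σ.injective (Fin.ext (by omega))

theorem signWord_inj {n : ℕ} {σ τ : Equiv.Perm (Fin n)} {ε δ : Fin n → Bool}
    (h : signWord σ ε = signWord τ δ) : σ = τ ∧ ε = δ := by
  constructor
  · ext i
    have := congrArg Int.natAbs (congrFun h i)
    rw [natAbs_signWord, natAbs_signWord] at this
    omega
  · funext i
    rw [Bool.eq_iff_iff, ← signWord_pos_iff σ, ← signWord_pos_iff τ, h]

theorem signWord_permInsert {n : ℕ} (i : Fin (n + 1)) (σ : Equiv.Perm (Fin n)) (e : Bool)
    (ε : Fin n → Bool) :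
    signWord (permInsert i σ) (i.insertNth (α := fun _ => Bool) e ε) =
      i.insertNth (α := fun _ => ℤ) (if e then (n : ℤ) + 1 else -((n : ℤ) + 1))
        (signWord σ ε) := by
  rw [Fin.eq_insertNth_iff]
  constructor
  · simp [signWord, permWord_permInsert]
  · funext j
    simp [signWord, permWord_permInsert, Fin.removeNth]

theorem signWord_not {n : ℕ} (σ : Equiv.Perm (Fin n)) (ε : Fin n → Bool) :
    signWord σ (fun i => !ε i) = fun i => -signWord σ ε i := by
  funext i
  cases h : ε i <;> simp [signWord, h]

theorem nodup_zero_cons_signWord {n : ℕ} (σ : Equiv.Perm (Fin n)) (ε : Fin n → Bool) :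
    (0 :: List.ofFn (signWord σ ε)).Nodup := by
  refine List.nodup_cons.2 ⟨fun h => ?_, List.nodup_ofFn.2 (signWord_injective σ ε)⟩
  obtain ⟨i, hi⟩ := (List.mem_ofFn' _ _).1 h
  have := natAbs_signWord σ ε i
  omega

/-- The generating polynomial of all signed permutations by the number of runs. -/
noncomputable def signedRunPoly (n : ℕ) : ℤ[X] :=
  ∑ σ : Equiv.Perm (Fin n), ∑ ε : Fin n → Bool, X ^ listRuns (0 :: List.ofFn (signWord σ ε))

theorem signedRunPoly_succ (n : ℕ) :
    signedRunPoly (n + 1) = ∑ σ : Equiv.Perm (Fin n), ∑ ε : Fin n → Bool, ∑ e : Bool,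
      ∑ i ∈ Finset.range (n + 1), X ^ listRuns (0 :: (List.ofFn (signWord σ ε)).insertIdx i
        (if e then (n : ℤ) + 1 else -((n : ℤ) + 1))) := by
  rw [signedRunPoly, sum_perm_succ]
  refine Finset.sum_congr rfl fun σ _ => ?_
  have h (i : Fin (n + 1)) : ∑ ε : Fin (n + 1) → Bool,
      (X : ℤ[X]) ^ listRuns (0 :: List.ofFn (signWord (permInsert i σ) ε))
      = ∑ ε : Fin n → Bool, ∑ e : Bool, X ^ listRuns (0 :: (List.ofFn (signWord σ ε)).insertIdx i
        (if e then (n : ℤ) + 1 else -((n : ℤ) + 1))) := by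
    rw [← (Fin.insertNthEquiv (fun _ => Bool) i).sum_comp, Fintype.sum_prod_type_right]
    have hi (p : Bool × (Fin n → Bool)) : Fin.insertNthEquiv (fun _ => Bool) i p
        = i.insertNth (α := fun _ => Bool) p.1 p.2 := rfl
    simp only [hi, signWord_permInsert, ofFn_insertNth]
  simp only [h]
  rw [Finset.sum_comm]
  refine Finset.sum_congr rfl fun ε _ => ?_
  rw [Finset.sum_comm]
  refine Finset.sum_congr rfl fun e _ => ?_
  rw [Fin.sum_univ_eq_sum_range (fun i => (X : ℤ[X]) ^ listRuns (0 ::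
    (List.ofFn (signWord σ ε)).insertIdx i (if e then (n : ℤ) + 1 else -((n : ℤ) + 1))))]

theorem signedRunPoly_one : signedRunPoly 1 = 2 * X := by
  rw [signedRunPoly_succ]
  simp [listRuns, turnCount]

/-- Of the two signs of the inserted letter, one points along the first step of the word and the
other against it, so the total does not depend on that direction. Working with all signed
permutations avoids tracking insertions that change the sign of the first letter. -/
theorem signedRunPoly_succ_succ (n : ℕ) : signedRunPoly (n + 2)
    = (2 * ((n : ℤ[X]) + 1) * X ^ 2 + 3 * X - 1) * signedRunPoly (n + 1)
      + 2 * X * (1 - X ^ 2) * derivative (signedRunPoly (n + 1)) := by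
  rw [signedRunPoly_succ, signedRunPoly]
  simp only [derivative_sum, Finset.mul_sum, ← Finset.sum_add_distrib]
  refine Finset.sum_congr rfl fun σ _ => Finset.sum_congr rfl fun ε _ => ?_
  set m : Bool → ℤ := fun e => if e then ((n + 1 : ℕ) : ℤ) + 1 else -(((n + 1 : ℕ) : ℤ) + 1)
    with hm
  have hz (e : Bool) : Beyond e (m e) 0 := by
    cases e <;> simp [Beyond, hm] <;> omega
  have hb (e : Bool) : ∀ b ∈ List.ofFn (signWord σ ε), Beyond e (m e) b := by
    intro b hb
    obtain ⟨i, rfl⟩ := (List.mem_ofFn' _ _).1 hb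
    have h1 := natAbs_signWord σ ε i
    have h2 := (σ i).2
    cases e <;> simp [Beyond, hm] <;> omega
  have hlen : (List.ofFn (signWord σ ε)).length = n + 1 := by simp
  have hsum : ∀ f : Bool → ℤ[X], ∀ e, ∑ e, f e = f e + f !e := by
    intro f e
    cases e <;> simp [add_comm]
  rw [List.ofFn_succ] at hb hlen ⊢
  have h1 := sum_listRuns_insertIdx_same _ _ 0 _ _ (hz _) (hb _) rfl
  have h2 := sum_listRuns_insertIdx_opposite (!decide (0 < signWord σ ε 0)) _ 0 _ _
    (hz _) (hb _) (by simp)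
  rw [List.length_ofFn] at h1 h2
  rw [hsum _ (decide (0 < signWord σ ε 0)), h1, h2]
  linear_combination (2 * X ^ 2 - 2) * X_mul_derivative_X_pow
    (listRuns (0 :: signWord σ ε 0 :: List.ofFn fun i => signWord σ ε i.succ))

/-! ### The polynomials t and binomial convolution -/

/-- The indicator of odd numbers, as a polynomial. -/
noncomputable def oddInd (m : ℕ) : ℤ[X] := if Odd m then 1 else 0

theorem t_succ (m : ℕ) : t (m + 1) = (-(1 + X) + 2 * X * oddInd m) * t m := by
  rcases Nat.even_or_odd' m with ⟨k, rfl | rfl⟩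
  · have h1 : Odd (2 * k + 1) := by simp
    have h2 : ¬ Odd (2 * k) := by simp
    have h3 : (2 * k + 1 - 1) / 2 = k := by omega
    have h4 : 2 * k / 2 = k := by omega
    simp only [t, oddInd, h1, h2, h3, h4, if_true, if_false]; ring
  · have h1 : Odd (2 * k + 1) := by simp
    have h2 : ¬ Odd (2 * k + 1 + 1) := by simp [Nat.even_add_one]
    have h3 : (2 * k + 1 - 1) / 2 = k := by omega
    have h4 : (2 * k + 1 + 1) / 2 = k + 1 := by omega
    simp only [t, oddInd, h1, h2, h3, h4, if_true, if_false]; ring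

theorem derivative_t (m : ℕ) :
    (1 - X ^ 2) * derivative (t m) = (-(m : ℤ[X]) * X + oddInd m) * t m := by
  have key (k : ℕ) : (1 - X ^ 2) * derivative ((1 - X ^ 2 : ℤ[X]) ^ k)
      = -(2 * (k : ℤ[X]) * X) * (1 - X ^ 2) ^ k := by
    cases k with
    | zero => simp
    | succ k =>
      simp [derivative_pow]
      ring
  rcases Nat.even_or_odd' m with ⟨k, rfl | rfl⟩
  · have h2 : ¬ Odd (2 * k) := by simp
    have h4 : 2 * k / 2 = k := by omega
    simp only [t, oddInd, h2, h4, if_false, derivative_neg]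
    push_cast
    linear_combination - key k
  · have h1 : Odd (2 * k + 1) := by simp
    have h3 : (2 * k + 1 - 1) / 2 = k := by omega
    simp only [t, oddInd, h1, h3, if_true, derivative_mul]
    have : derivative (1 + X : ℤ[X]) = 1 := by simp
    rw [this]
    push_cast
    linear_combination (1 + X) * key k

/-- A sequence with the recurrence of the type `B` alternating run polynomials, convolved with
`t`, satisfies the recurrence of `2 ^ n * X * S n`. -/
theorem convolution_succ (V : ℕ → ℤ[X])
    (hV : ∀ j, V (j + 1) = (2 * ((j : ℤ[X]) + 1) * X ^ 2 + 3 * X - 1) * V j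
      + 2 * X * (1 - X ^ 2) * derivative (V j)) (n : ℕ) :
    ∑ p ∈ Finset.HasAntidiagonal.antidiagonal (n + 1), ((n + 1).choose p.1 : ℤ[X]) * (V p.1 * t p.2)
      = (2 * X - 2 + 2 * ((n : ℤ[X]) + 1) * X ^ 2)
          * ∑ p ∈ Finset.HasAntidiagonal.antidiagonal n, (n.choose p.1 : ℤ[X]) * (V p.1 * t p.2)
        + 2 * X * (1 - X ^ 2)
          * derivative (∑ p ∈ Finset.HasAntidiagonal.antidiagonal n, (n.choose p.1 : ℤ[X]) * (V p.1 * t p.2)) := by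
  rw [Finset.sum_antidiagonal_choose_succ_mul (fun i j => V i * t j), derivative_sum,
    Finset.mul_sum, Finset.mul_sum, ← Finset.sum_add_distrib, ← Finset.sum_add_distrib]
  refine Finset.sum_congr rfl fun p hp => ?_
  rw [Finset.HasAntidiagonal.mem_antidiagonal] at hp
  have hc : n.choose p.2 = n.choose p.1 := Nat.choose_symm_of_eq_add (by omega)
  have hn : (n : ℤ[X]) = p.1 + p.2 := by rw [← hp]; push_cast; rfl
  simp only [hc, hV, t_succ, derivative_mul, derivative_natCast, hn]
  -- The parity terms of `t_succ` and `derivative_t` cancel, and the coefficients of X² from the two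
  -- factors add up to one depending only on p.1 + p.2 = n.
  linear_combination (-2 * X * (n.choose p.1 : ℤ[X]) * V p.1) * derivative_t p.2

theorem convolution_eq (V W : ℕ → ℤ[X]) (h0 : V 0 = X * W 0)
    (hV : ∀ j, V (j + 1) = (2 * ((j : ℤ[X]) + 1) * X ^ 2 + 3 * X - 1) * V j
      + 2 * X * (1 - X ^ 2) * derivative (V j))
    (hW : ∀ n, W (n + 1) = (X + (n : ℤ[X]) * X ^ 2) * W n + X * (1 - X ^ 2) * derivative (W n))
    (n : ℕ) :
    ∑ p ∈ Finset.HasAntidiagonal.antidiagonal n, (n.choose p.1 : ℤ[X]) * (V p.1 * t p.2)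
      = -(2 ^ n * X * W n) := by
  induction n with
  | zero => simp [t, h0]
  | succ n ih =>
    have h2 : derivative ((2 : ℤ[X]) ^ n) = 0 := by
      rw [show (2 : ℤ[X]) ^ n = ((2 ^ n : ℕ) : ℤ[X]) by push_cast; rfl, derivative_natCast]
    rw [convolution_succ V hV, ih, hW]
    simp only [derivative_neg, derivative_mul, derivative_X, h2]
    ring

/-- Since t_0 = -1, the last term of the convolution is `-V n`; it is moved to the other side. -/
theorem recurrence_of_convolution (V W : ℕ → ℤ[X]) (n : ℕ)
    (h : ∑ p ∈ Finset.HasAntidiagonal.antidiagonal n, (n.choose p.1 : ℤ[X]) * (V p.1 * t p.2)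
      = -(2 ^ n * X * W n)) :
    V n = 2 ^ n * X * W n + ∑ r ∈ Finset.Icc 2 (n + 1),
      C (n.choose (r - 2) : ℤ) * t (n + 2 - r) * V (r - 2) := by
  rw [Finset.Nat.sum_antidiagonal_eq_sum_range_succ (fun i j => (n.choose i : ℤ[X]) * (V i * t j)),
    Finset.sum_range_succ] at h
  have : ∑ r ∈ Finset.Icc 2 (n + 1), C (n.choose (r - 2) : ℤ) * t (n + 2 - r) * V (r - 2)
      = ∑ i ∈ Finset.range n, (n.choose i : ℤ[X]) * (V i * t (n - i)) := by
    rw [← Finset.Ico_succ_right_eq_Icc, Finset.sum_Ico_eq_sum_range]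
    refine Finset.sum_congr (by simp) fun i _ => ?_
    have h1 : n + 2 - (2 + i) = n - i := by omega
    have h2 : 2 + i - 2 = i := by omega
    rw [h1, h2]
    simp only [map_natCast]
    ring
  rw [this]
  have t_zero : t 0 = -1 := by simp [t]
  rw [Nat.sub_self, Nat.choose_self, t_zero, Nat.cast_one] at h
  linear_combination -h

/-! ### Signed permutations as permutations with signs -/

theorem PMSet.ne_zero {n : ℕ} (z : PMSet n) : z.1 ≠ 0 := (Finset.mem_erase.1 z.2).1

theorem PMSet.natAbs_le {n : ℕ} (z : PMSet n) : z.1.natAbs ≤ n := by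
  have := Finset.mem_Icc.1 (Finset.mem_erase.1 z.2).2
  omega

/-- The index of the absolute value of an element of `±[n]`. -/
def PMSet.idx {n : ℕ} (z : PMSet n) : Fin n :=
  ⟨z.1.natAbs - 1, by have := z.ne_zero; have := z.natAbs_le; omega⟩

theorem PMSet.eq_pos_or_neg {n : ℕ} (z : PMSet n) :
    z = PMSet.pos z.idx ∨ z = (PMSet.pos z.idx).neg := by
  have := z.ne_zero
  simp only [Subtype.ext_iff, PMSet.pos, PMSet.neg, PMSet.idx]
  omega

theorem PMSet.idx_pos {n : ℕ} (i : Fin n) : (PMSet.pos i).idx = i := by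
  ext
  simp only [PMSet.pos, PMSet.idx]
  omega

/-- The signed permutation with absolute values `σ` and signs `ε`, as a map. -/
def signedMap {n : ℕ} (σ : Equiv.Perm (Fin n)) (ε : Fin n → Bool) (z : PMSet n) : PMSet n :=
  ⟨z.1.sign * signWord σ ε z.idx, by
    have h1 := natAbs_signWord σ ε z.idx
    have h2 := (σ z.idx).2
    rw [Finset.mem_erase, Finset.mem_Icc]
    rcases lt_or_gt_of_ne z.ne_zero with h | h
    · rw [Int.sign_eq_neg_one_of_neg h]; omega
    · rw [Int.sign_eq_one_of_pos h]; omega⟩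

theorem signedMap_pos {n : ℕ} (σ : Equiv.Perm (Fin n)) (ε : Fin n → Bool) (i : Fin n) :
    (signedMap σ ε (PMSet.pos i)).1 = signWord σ ε i := by
  have h : (PMSet.pos i).1.sign = 1 := Int.sign_eq_one_of_pos (by simp only [PMSet.pos]; omega)
  simp only [signedMap, h, one_mul, PMSet.idx_pos]

theorem signedMap_neg {n : ℕ} (σ : Equiv.Perm (Fin n)) (ε : Fin n → Bool) (z : PMSet n) :
    signedMap σ ε z.neg = (signedMap σ ε z).neg := by
  simp [signedMap, PMSet.neg, PMSet.idx]

theorem signedMap_injective {n : ℕ} (σ : Equiv.Perm (Fin n)) (ε : Fin n → Bool) :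
    Function.Injective (signedMap σ ε) := by
  intro y z h
  have h := congrArg Subtype.val h
  have hi : y.idx = z.idx := by
    have h' := congrArg Int.natAbs h
    simp only [signedMap, Int.natAbs_mul, natAbs_signWord,
      Int.natAbs_sign_of_ne_zero y.ne_zero, Int.natAbs_sign_of_ne_zero z.ne_zero] at h'
    exact σ.injective (Fin.ext (by omega))
  simp only [signedMap, hi] at h
  have hne : signWord σ ε z.idx ≠ 0 := by
    have := natAbs_signWord σ ε z.idx
    omega
  have hs := mul_right_cancel₀ hne h
  have ha : y.1.natAbs = z.1.natAbs := by
    have h1 := congrArg Fin.val hi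
    have h2 := y.ne_zero
    have h3 := z.ne_zero
    simp only [PMSet.idx] at h1
    omega
  ext
  rw [← Int.sign_mul_natAbs y.1, ← Int.sign_mul_natAbs z.1, hs, ha]

/-- The signed permutation with absolute values `σ` and signs `ε`. -/
noncomputable def signedPerm {n : ℕ} (p : Equiv.Perm (Fin n) × (Fin n → Bool)) : SignedPerm n :=
  ⟨Equiv.ofBijective (signedMap p.1 p.2)
    (Finite.injective_iff_bijective.1 (signedMap_injective p.1 p.2)), signedMap_neg p.1 p.2⟩

theorem signedPerm_pos {n : ℕ} (p : Equiv.Perm (Fin n) × (Fin n → Bool)) (i : Fin n) :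
    ((signedPerm p).1 (PMSet.pos i)).1 = signWord p.1 p.2 i := signedMap_pos p.1 p.2 i

theorem SignedPerm.ext_pos {n : ℕ} {π ρ : SignedPerm n}
    (h : ∀ i, (π.1 (PMSet.pos i)).1 = (ρ.1 (PMSet.pos i)).1) : π = ρ := by
  refine Subtype.ext (Equiv.ext fun z => ?_)
  rcases z.eq_pos_or_neg with hz | hz <;> rw [hz]
  · exact Subtype.ext (h _)
  · rw [π.2, ρ.2, Subtype.ext (h _)]

theorem signedPerm_bijective (n : ℕ) : Function.Bijective (signedPerm (n := n)) := by
  constructor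
  · rintro ⟨σ, ε⟩ ⟨τ, δ⟩ h
    have : signWord σ ε = signWord τ δ := by
      funext i
      rw [← signedPerm_pos (σ, ε), h, signedPerm_pos]
    obtain ⟨rfl, rfl⟩ := signWord_inj this
    rfl
  · intro π
    -- Equal absolute values mean π(i) = ±π(j) = π(±j), and two positive positions then coincide.
    have hinj : Function.Injective fun i : Fin n => (π.1 (PMSet.pos i)).idx := by
      intro i j h
      simp only at h
      have hij : π.1 (PMSet.pos i) = π.1 (PMSet.pos j) ∨
          π.1 (PMSet.pos i) = (π.1 (PMSet.pos j)).neg := by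
        rcases (π.1 (PMSet.pos i)).eq_pos_or_neg with h1 | h1 <;>
        rcases (π.1 (PMSet.pos j)).eq_pos_or_neg with h2 | h2 <;>
        rw [h1, h2, h] <;> simp [PMSet.neg]
      rw [← π.2, π.1.injective.eq_iff, π.1.injective.eq_iff] at hij
      simp only [PMSet.pos, PMSet.neg, Subtype.ext_iff] at hij
      exact Fin.ext (by omega)
    refine ⟨(Equiv.ofBijective _ (Finite.injective_iff_bijective.1 hinj),
      fun i => decide (0 < (π.1 (PMSet.pos i)).1)), SignedPerm.ext_pos fun i => ?_⟩
    rw [signedPerm_pos]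
    have := (π.1 (PMSet.pos i)).ne_zero
    simp only [signWord, permWord, Equiv.ofBijective_apply, PMSet.idx, decide_eq_true_eq]
    split_ifs <;> omega

theorem runCount_signedPerm {n : ℕ} (p : Equiv.Perm (Fin n) × (Fin n → Bool)) :
    runCount (signedWord (signedPerm p)) = listRuns (0 :: List.ofFn (signWord p.1 p.2)) := by
  have h : List.ofFn (signedWord (signedPerm p)) = 0 :: List.ofFn (signWord p.1 p.2) := by
    simp only [signedWord, signedPerm_pos, List.ofFn_cons]
  rw [runCount_eq_listRuns, h]
  rw [← List.nodup_ofFn, h]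
  exact nodup_zero_cons_signWord _ _

/-! ### The recurrence for T -/

theorem T_eq_sum_filter (n : ℕ) : T (n + 1)
    = ∑ π : SignedPerm (n + 1) with IsUp π, X ^ runCount (signedWord π) := by
  have hmem : ∀ π ∈ (Finset.univ : Finset (SignedPerm (n + 1))).filter IsUp,
      runCount (signedWord π) ∈ Finset.Icc 1 (n + 1) := by
    intro π _
    obtain ⟨p, rfl⟩ := (signedPerm_bijective _).2 π
    rw [runCount_signedPerm, List.ofFn_succ, Finset.mem_Icc]
    have := turnCount_le_length (decide (0 < signWord p.1 p.2 0)) (signWord p.1 p.2 0)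
      (List.ofFn fun i => signWord p.1 p.2 i.succ)
    rw [List.length_ofFn] at this
    simp only [listRuns]
    omega
  rw [T, ← Finset.sum_fiberwise_of_maps_to hmem]
  refine Finset.sum_congr rfl fun k _ => ?_
  rw [Finset.sum_congr rfl fun π hπ => by rw [(Finset.mem_filter.1 hπ).2], Finset.sum_const,
    Finset.filter_filter, upRunNumber]
  simp

/-- Negating all values preserves the number of runs and exchanges the words with positive and
negative first letter. -/
theorem two_mul_T (n : ℕ) : 2 * T (n + 1) = signedRunPoly (n + 1) := by
  have hT : T (n + 1) = ∑ σ : Equiv.Perm (Fin (n + 1)), ∑ ε : Fin (n + 1) → Bool,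
      if ε 0 = true then X ^ listRuns (0 :: List.ofFn (signWord σ ε)) else 0 := by
    rw [T_eq_sum_filter, Finset.sum_filter,
      ← (Equiv.ofBijective _ (signedPerm_bijective (n + 1))).sum_comp, Fintype.sum_prod_type]
    refine Finset.sum_congr rfl fun σ _ => Finset.sum_congr rfl fun ε _ => ?_
    rw [Equiv.ofBijective_apply, runCount_signedPerm]
    congr 1
    rw [IsUp, eq_iff_iff, ← signWord_pos_iff σ]
    simp only [signedPerm_pos]
    refine ⟨fun h => h 0 rfl, fun h i hi => ?_⟩
    obtain rfl : i = 0 := Fin.ext hi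
    exact h
  rw [signedRunPoly, two_mul, hT, ← Finset.sum_add_distrib]
  refine Finset.sum_congr rfl fun σ _ => ?_
  have hneg : ∀ ε : Fin (n + 1) → Bool, listRuns (0 :: List.ofFn (signWord σ fun i => !ε i))
      = listRuns (0 :: List.ofFn (signWord σ ε)) := by
    intro ε
    have hanti : StrictAnti fun z : ℤ => -z := fun a b h => by simp only; omega
    rw [← listRuns_map_strictAnti hanti _ (nodup_zero_cons_signWord σ ε), signWord_not,
      List.map_cons, List.map_ofFn]
    rfl
  let e : (Fin (n + 1) → Bool) ≃ (Fin (n + 1) → Bool) :=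
    Function.Involutive.toPerm (fun ε i => !ε i) fun ε => by simp
  nth_rewrite 2 [← Equiv.sum_comp e]
  rw [← Finset.sum_add_distrib]
  refine Finset.sum_congr rfl fun ε _ => ?_
  have he : e ε = fun i => !ε i := rfl
  rw [he, hneg]
  cases h : ε 0 <;> simp [h]

theorem T_one : T 1 = X := by
  have h := two_mul_T 0
  rw [signedRunPoly_one] at h
  exact mul_left_cancel₀ two_ne_zero h

theorem T_succ_succ (n : ℕ) : T (n + 2) = (2 * ((n : ℤ[X]) + 1) * X ^ 2 + 3 * X - 1) * T (n + 1)
    + 2 * X * (1 - X ^ 2) * derivative (T (n + 1)) := by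
  have h := signedRunPoly_succ_succ n
  rw [← two_mul_T, ← two_mul_T, derivative_mul] at h
  have h2 : derivative (2 : ℤ[X]) = 0 := derivative_ofNat 2
  rw [h2] at h
  exact mul_left_cancel₀ two_ne_zero (by linear_combination h)

theorem S_zero : S 0 = 1 := by
  simp [S_eq, listRuns]

end AltRuns

theorem mainTheorem12 (n : ℕ) (hn : 1 ≤ n) :
    AltRuns.T (n + 1) = 2 ^ n * X * AltRuns.S n +
        ∑ r ∈ Finset.Icc 2 (n + 1),
          C (n.choose (r - 2) : ℤ) * AltRuns.t (n + 2 - r) * AltRuns.T (r - 1) ∧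
      (2 ≤ n →
        AltRuns.T (n + 1) = 2 ^ (n - 1) * X * (1 + X) * AltRuns.R n +
          ∑ r ∈ Finset.Icc 2 (n + 1),
            C (n.choose (r - 2) : ℤ) * AltRuns.t (n + 2 - r) * AltRuns.T (r - 1)) := by
  have h0 : AltRuns.T (0 + 1) = X * AltRuns.S 0 := by
    rw [zero_add, AltRuns.T_one, AltRuns.S_zero, mul_one]
  have h := AltRuns.recurrence_of_convolution (fun j => AltRuns.T (j + 1)) AltRuns.S n
    (AltRuns.convolution_eq (fun j => AltRuns.T (j + 1)) AltRuns.S h0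
      (fun j => AltRuns.T_succ_succ j) AltRuns.S_succ n)
  -- The convolution was run on the shifted sequence `T (j + 1)`; the shift is undone here, using r
  -- ≥ 2 against truncated subtraction.
  have hr : ∑ r ∈ Finset.Icc 2 (n + 1),
        C (n.choose (r - 2) : ℤ) * AltRuns.t (n + 2 - r) * AltRuns.T (r - 2 + 1)
      = ∑ r ∈ Finset.Icc 2 (n + 1),
        C (n.choose (r - 2) : ℤ) * AltRuns.t (n + 2 - r) * AltRuns.T (r - 1) := by
    refine Finset.sum_congr rfl fun r hr => ?_
    rw [show r - 2 + 1 = r - 1 by have := (Finset.mem_Icc.1 hr).1; omega]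
  simp only [hr] at h
  refine ⟨h, fun h2 => h.trans ?_⟩
  obtain ⟨m, rfl⟩ := Nat.exists_eq_add_of_le' hn
  rw [Nat.add_sub_cancel]
  linear_combination 2 ^ m * X * AltRuns.two_mul_S (m + 1) h2
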